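/- A residuated lattice is an algebra $\langle A,*,\to,\lor,\land,\top\rangle$ such that $\langle A,*,\top\rangle$ is a commutative monoid, $\langle A,\lor,\land\rangle$ is a lattice with greatest element $\top$, and $x*y\le z\iff x\le y\to z$. It is bounded if it has a least element $\bot$ that is a constant of the language; then $\neg x:=x\to\bot$. A Stonean residuated lattice is a bounded residuated lattice with $\neg x\lor\neg\neg x=\top$. For a residuated lattice $A$, $\mathbf S(A)$ is the Stonean residuated lattice obtained by adjoining a new bottom element $o$ to $A$, with $x*o=o*x=o$, $o\to x=\top$, and $a\to o=o$ for $a\in A$. For a variety $\mathbb V$ of Stonean residuated lattices put $\mathbb V^*=\{A \text{ a residuated lattice}: \mathbf S(A)\in\mathbb V\}$. $\mathrm{Free}_{\mathbb V}(n)$ and $\mathrm{Free}_{\mathbb V^*}(k)$ denote the free algebras on $n$ and $k$ generators in $\mathbb V$ and $\mathbb V^*$. An i-filter of a residuated lattice $D$ is a set $F\subseteq D$ with $\top\in F$ such that $x,\,x\to y\in F$ imply $y\in F$; the i-filters, ordered by inclusion, form a bounded lattice $\mathcal F_i(D)$. A triple $(B,D,\phi)$ consists of a Boolean algebra $B$,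 a residuated lattice $D$, and a bounded lattice homomorphism $\phi:B\to\mathcal F_i(D)$. A morphism $(B_1,D_1,\phi_1)\to(B_2,D_2,\phi_2)$ is a pair of homomorphisms $h:B_1\to B_2$, $k:D_1\to D_2$ with $k(\phi_1(a))\subseteq\phi_2(h(a))$ for all $a\in B_1$. The triple associated with a Stonean residuated lattice $A$ is $(B(A),D(A),\phi_A)$, where $B(A)$ is the Boolean algebra of the complemented elements of $A$, $D(A)=\{x\in A:\neg x=\bot\}$ is the residuated lattice of dense elements, and $\phi_A(a)=\{x\in D(A):x\ge\neg a\}$. **Theorem 4.7 (free algebras).** Let $\mathbb V$ be a variety of Stonean residuated lattices that properly contains the variety of Boolean algebras, and let $n\ge 0$ be an integer. Then $$\mathrm{Free}_{\mathbb V}(n)\;\cong\;\prod_{k=0}^n \mathbf S\bigl(\mathrm{Free}_{\mathbb V^*}(k)\bigr)^{\binom nk}.$$ Moreover, for $j=1,\dots,2^n$ let $k_j=\min\{k:\sum_{l=0}^k\binom nl\ge j\}$. The triple associated with $\mathrm{Free}_{\mathbb V}(n)$ is isomorphic to $(\mathbf B^{2^n},D,\phi)$, where $\mathbf B=\{0,1\}$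 is the two-element Boolean algebra, $$D=\prod_{j=1}^{2^n}\mathrm{Free}_{\mathbb V^*}(k_j)\;\cong\;\prod_{k=0}^n\mathrm{Free}_{\mathbb V^*}(k)^{\binom nk},$$ and $\phi(b_1,\dots,b_{2^n})=\prod_{j=1}^{2^n}\phi_{j,b_j}$ with $\phi_{j,0}=\{\top\}$ and $\phi_{j,1}=\mathrm{Free}_{\mathbb V^*}(k_j)$. -/

import Mathlib

universe u v

/-! ### Residuated lattices -/

/-- Integral commutative residuated lattices `⟨A, *, ⇨, ⊔, ⊓, ⊤⟩`. The unit `1` of the monoid is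
the greatest element `⊤`. -/
class ResLattice (A : Type u) extends Lattice A, OrderTop A, CommMonoid A, HImp A where
  one_eq_top : (1 : A) = ⊤
  mul_le_iff : ∀ x y z : A, x * y ≤ z ↔ x ≤ y ⇨ z

/-- Bounded residuated lattices. -/
class BddResLattice (A : Type u) extends ResLattice A, OrderBot A

namespace ResLattice

variable {A : Type u} [ResLattice A]

theorem top_mul' (x : A) : ⊤ * x = x := by rw [← one_eq_top, one_mul]

theorem mul_top' (x : A) : x * ⊤ = x := by rw [← one_eq_top, mul_one]

theorem himp_mul_le (x y : A) : (x ⇨ y) * x ≤ y := (mul_le_iff _ _ _).2 le_rfl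

theorem mul_himp_le (x y : A) : x * (x ⇨ y) ≤ y := by rw [mul_comm]; exact himp_mul_le x y

theorem mul_mono_left {x y : A} (h : x ≤ y) (z : A) : x * z ≤ y * z :=
  (mul_le_iff _ _ _).2 (h.trans ((mul_le_iff _ _ _).1 le_rfl))

theorem mul_mono {x y z w : A} (h : x ≤ y) (h' : z ≤ w) : x * z ≤ y * w := by
  refine (mul_mono_left h z).trans ?_
  rw [mul_comm y z, mul_comm y w]
  exact mul_mono_left h' y

theorem mul_le_left' (x y : A) : x * y ≤ x := by
  simpa [mul_top'] using mul_mono (le_refl x) (le_top : y ≤ ⊤)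

theorem mul_le_right' (x y : A) : x * y ≤ y := by
  simpa [top_mul'] using mul_mono (le_top : x ≤ ⊤) (le_refl y)

theorem himp_top_iff {x y : A} : x ⇨ y = ⊤ ↔ x ≤ y := by
  rw [← top_le_iff, ← mul_le_iff, top_mul']

theorem sup_mul' (x y z : A) : (x ⊔ y) * z = x * z ⊔ y * z := by
  apply le_antisymm
  · rw [mul_le_iff]
    exact sup_le ((mul_le_iff _ _ _).1 le_sup_left) ((mul_le_iff _ _ _).1 le_sup_right)
  · exact sup_le (mul_mono_left le_sup_left z) (mul_mono_left le_sup_right z)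

theorem mul_sup' (x y z : A) : x * (y ⊔ z) = x * y ⊔ x * z := by
  rw [mul_comm, sup_mul', mul_comm y, mul_comm z]

end ResLattice

/-- Homomorphisms of residuated lattices. -/
@[ext]
structure RLHom (A : Type u) (B : Type v) [ResLattice A] [ResLattice B] where
  toFun : A → B
  map_mul : ∀ x y, toFun (x * y) = toFun x * toFun y
  map_himp : ∀ x y, toFun (x ⇨ y) = toFun x ⇨ toFun y
  map_sup : ∀ x y, toFun (x ⊔ y) = toFun x ⊔ toFun y
  map_inf : ∀ x y, toFun (x ⊓ y) = toFun x ⊓ toFun y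
  map_top : toFun ⊤ = ⊤

/-- Homomorphisms of bounded residuated lattices. -/
@[ext]
structure BRLHom (A : Type u) (B : Type v) [BddResLattice A] [BddResLattice B] extends
    RLHom A B where
  map_bot : toFun ⊥ = ⊥

/-- Isomorphisms of residuated lattices: bijective homomorphisms. -/
structure RLIso (A : Type u) (B : Type v) [ResLattice A] [ResLattice B] extends RLHom A B where
  bijective : Function.Bijective toFun

/-- Isomorphisms of bounded residuated lattices: bijective homomorphisms. -/
structure BRLIso (A : Type u) (B : Type v) [BddResLattice A] [BddResLattice B] extends
    BRLHom A B where
  bijective : Function.Bijective toFun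

/-- Direct products, with the pointwise operations. -/
instance Pi.instResLattice {ι : Type v} {F : ι → Type u} [∀ i, ResLattice (F i)] :
    ResLattice (∀ i, F i) where
  one_eq_top := funext fun _ => ResLattice.one_eq_top
  mul_le_iff x y z := forall_congr' fun i => ResLattice.mul_le_iff (x i) (y i) (z i)

instance Pi.instBddResLattice {ι : Type v} {F : ι → Type u} [∀ i, BddResLattice (F i)] :
    BddResLattice (∀ i, F i) where

/-! ### Adjoining a new bottom -/

/-- `S(A)`: the residuated lattice `A` with a new bottom element adjoined. -/
def SExt (A : Type u) : Type u := WithBot A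

namespace SExt

variable {A : Type u}

/-- The inclusion of `A` in `S(A)`. -/
def elt (a : A) : SExt A := (a : WithBot A)

/-- The new element of `S(A)`. -/
def o : SExt A := (⊥ : WithBot A)

@[elab_as_elim]
theorem cases {p : SExt A → Prop} (ho : p o) (he : ∀ a, p (elt a)) (x : SExt A) : p x :=
  WithBot.recBotCoe ho he x

theorem elt_injective : Function.Injective (elt : A → SExt A) := WithBot.coe_injective

theorem elt_ne_o (a : A) : elt a ≠ o := WithBot.coe_ne_bot

/-- The map that is `f` on `A` and takes the value `d` at the new element. -/
def lift {C : Type v} (d : C) (f : A → C) (x : SExt A) : C :=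
  WithBot.recBotCoe (C := fun _ => C) d f x

@[simp] theorem lift_o {C : Type v} (d : C) (f : A → C) : lift d f o = d := rfl
@[simp] theorem lift_elt {C : Type v} (d : C) (f : A → C) (a : A) : lift d f (elt a) = f a := rfl

variable [ResLattice A]

instance : Lattice (SExt A) := inferInstanceAs (Lattice (WithBot A))
instance : OrderTop (SExt A) := inferInstanceAs (OrderTop (WithBot A))
instance : OrderBot (SExt A) := inferInstanceAs (OrderBot (WithBot A))

/-- `x * y` is computed in `A` for `x, y ∈ A` and is `o` otherwise. -/
instance : Mul (SExt A) := ⟨fun x y => lift o (fun a => lift o (fun b => elt (a * b)) y) x⟩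

/-- `x ⇨ y` is computed in `A` for `x, y ∈ A`; `x ⇨ o = o` for `x ∈ A`; `o ⇨ y = ⊤`. -/
instance : HImp (SExt A) := ⟨fun x y => lift ⊤ (fun a => lift o (fun b => elt (a ⇨ b)) y) x⟩

theorem bot_eq : (⊥ : SExt A) = o := rfl
theorem top_eq : (⊤ : SExt A) = elt ⊤ := rfl
theorem o_le (x : SExt A) : o ≤ x := bot_le
theorem elt_le {a b : A} : elt a ≤ elt b ↔ a ≤ b := WithBot.coe_le_coe
theorem not_elt_le_o (a : A) : ¬ elt a ≤ o := fun h => elt_ne_o a (le_antisymm h (o_le _))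
theorem elt_sup (a b : A) : elt (a ⊔ b) = elt a ⊔ elt b := rfl
theorem elt_inf (a b : A) : elt (a ⊓ b) = elt a ⊓ elt b := rfl
@[simp] theorem o_sup (x : SExt A) : o ⊔ x = x := bot_sup_eq x
@[simp] theorem sup_o (x : SExt A) : x ⊔ o = x := sup_bot_eq x
@[simp] theorem o_inf (x : SExt A) : o ⊓ x = o := bot_inf_eq x
@[simp] theorem inf_o (x : SExt A) : x ⊓ o = o := inf_bot_eq x
@[simp] theorem elt_mul (a b : A) : elt a * elt b = elt (a * b) := rfl
@[simp] theorem o_mul (x : SExt A) : o * x = o := rfl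
@[simp] theorem mul_o (x : SExt A) : x * o = o := by
  induction x using cases <;> rfl
@[simp] theorem elt_himp (a b : A) : elt a ⇨ elt b = elt (a ⇨ b) := rfl
@[simp] theorem o_himp (x : SExt A) : o ⇨ x = ⊤ := rfl
@[simp] theorem elt_himp_o (a : A) : elt a ⇨ o = o := rfl

instance : BddResLattice (SExt A) where
  one := ⊤
  mul_assoc x y z := by
    induction x using cases <;> induction y using cases <;> induction z using cases <;>
      simp [mul_assoc]
  mul_comm x y := by
    induction x using cases <;> induction y using cases <;> simp [mul_comm]
  one_mul x := by
    change elt ⊤ * x = x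
    induction x using cases <;> simp [ResLattice.top_mul']
  mul_one x := by
    change x * elt ⊤ = x
    induction x using cases <;> simp [ResLattice.mul_top']
  one_eq_top := rfl
  mul_le_iff x y z := by
    induction x using cases <;> induction y using cases <;> induction z using cases <;>
      simp [o_le, not_elt_le_o, elt_le, ResLattice.mul_le_iff]

end SExt

/-! ### Boolean and dense elements -/

namespace BddResLattice

variable {A : Type u} [BddResLattice A]

/-- The negation `¬ x = x ⇨ ⊥`. -/
def neg (x : A) : A := x ⇨ ⊥

/-- The Boolean (complemented) elements. -/
def IsBool (a : A) : Prop := a ⊔ neg a = ⊤ ∧ a ⊓ neg a = ⊥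

/-- The dense elements. -/
def IsDense (a : A) : Prop := neg a = ⊥

open ResLattice

theorem le_neg_iff {x y : A} : x ≤ neg y ↔ x * y = ⊥ := by
  rw [neg, ← mul_le_iff, le_bot_iff]

theorem mul_neg (x : A) : x * neg x = ⊥ := le_bot_iff.1 (mul_himp_le x ⊥)

theorem neg_anti {x y : A} (h : x ≤ y) : neg y ≤ neg x := by
  rw [le_neg_iff, ← le_bot_iff, ← mul_neg y, mul_comm]
  exact mul_mono_left h _

theorem le_neg_neg (x : A) : x ≤ neg (neg x) := by rw [le_neg_iff, mul_neg]

theorem neg_top : neg (⊤ : A) = ⊥ := by rw [← mul_neg (⊤ : A), top_mul']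

theorem neg_bot : neg (⊥ : A) = ⊤ := himp_top_iff.2 le_rfl

theorem neg_sup (x y : A) : neg (x ⊔ y) = neg x ⊓ neg y := by
  apply le_antisymm (le_inf (neg_anti le_sup_left) (neg_anti le_sup_right))
  rw [le_neg_iff, mul_sup', le_neg_iff.1 inf_le_left, le_neg_iff.1 inf_le_right, sup_idem]

theorem IsBool.of_sup {a : A} (h : a ⊔ neg a = ⊤) : IsBool a := by
  refine ⟨h, le_bot_iff.1 ?_⟩
  rw [← neg_top, ← h, neg_sup, inf_comm]
  exact inf_le_inf le_rfl (le_neg_neg a)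

theorem IsBool.mul_eq {a : A} (h : IsBool a) (x : A) : a * x = a ⊓ x := by
  apply le_antisymm (le_inf (mul_le_left' _ _) (mul_le_right' _ _))
  calc a ⊓ x = (a ⊔ neg a) * (a ⊓ x) := by rw [h.1, top_mul']
    _ = a * (a ⊓ x) ⊔ neg a * (a ⊓ x) := sup_mul' _ _ _
    _ ≤ a * x := by
        refine sup_le (mul_mono le_rfl inf_le_right) ?_
        refine (mul_mono le_rfl inf_le_left).trans ?_
        rw [mul_comm, mul_neg]
        exact bot_le

theorem IsBool.inf_sup {a : A} (h : IsBool a) (x y : A) : a ⊓ (x ⊔ y) = a ⊓ x ⊔ a ⊓ y := by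
  rw [← h.mul_eq, ← h.mul_eq, ← h.mul_eq, mul_sup']

theorem IsBool.neg {a : A} (h : IsBool a) : IsBool (neg a) := by
  apply IsBool.of_sup
  rw [← top_le_iff, ← h.1, sup_comm]
  exact sup_le_sup le_rfl (le_neg_neg a)

theorem IsBool.neg_neg {a : A} (h : IsBool a) : BddResLattice.neg (BddResLattice.neg a) = a := by
  apply le_antisymm _ (le_neg_neg a)
  have h1 := h.neg.neg.inf_sup a (BddResLattice.neg a)
  rw [h.1, inf_top_eq, inf_comm _ (BddResLattice.neg a), h.neg.2, sup_bot_eq] at h1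
  rw [h1]
  exact inf_le_right

theorem IsBool.neg_inf {a b : A} (ha : IsBool a) (hb : IsBool b) :
    BddResLattice.neg (a ⊓ b) = BddResLattice.neg a ⊔ BddResLattice.neg b := by
  apply le_antisymm _ (sup_le (neg_anti inf_le_left) (neg_anti inf_le_right))
  set n := BddResLattice.neg (a ⊓ b) with hn
  have h0 : n * (a * b) = ⊥ := by rw [ha.mul_eq, mul_comm]; exact mul_neg _
  calc n = n * ((a ⊔ BddResLattice.neg a) * (b ⊔ BddResLattice.neg b)) := by
        rw [ha.1, hb.1, mul_top', mul_top']
    _ ≤ BddResLattice.neg a ⊔ BddResLattice.neg b := by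
        rw [sup_mul', mul_sup' a, mul_sup' (BddResLattice.neg a), mul_sup', mul_sup', mul_sup', h0]
        refine sup_le (sup_le bot_le ?_) (sup_le ?_ ?_)
        · exact (mul_le_right' _ _).trans ((mul_le_right' _ _).trans le_sup_right)
        · exact (mul_le_right' _ _).trans ((mul_le_left' _ _).trans le_sup_left)
        · exact (mul_le_right' _ _).trans ((mul_le_left' _ _).trans le_sup_left)

theorem IsBool.inf {a b : A} (ha : IsBool a) (hb : IsBool b) : IsBool (a ⊓ b) := by
  apply IsBool.of_sup
  rw [ha.neg_inf hb, ← top_le_iff, ← ha.1]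
  refine sup_le ?_ (le_sup_left.trans le_sup_right)
  calc a = a ⊓ (b ⊔ BddResLattice.neg b) := by rw [hb.1, inf_top_eq]
    _ = a ⊓ b ⊔ a ⊓ BddResLattice.neg b := ha.inf_sup _ _
    _ ≤ _ := sup_le_sup le_rfl (inf_le_right.trans le_sup_right)

theorem IsBool.sup {a b : A} (ha : IsBool a) (hb : IsBool b) : IsBool (a ⊔ b) := by
  have h := (ha.neg.inf hb.neg).neg
  rwa [ha.neg.neg_inf hb.neg, ha.neg_neg, hb.neg_neg] at h

theorem IsBool.top : IsBool (⊤ : A) := IsBool.of_sup (by simp)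

theorem IsBool.bot : IsBool (⊥ : A) := IsBool.of_sup (by simp [neg_bot])

theorem IsDense.of_le {x y : A} (hx : IsDense x) (h : x ≤ y) : IsDense y :=
  le_bot_iff.1 ((neg_anti h).trans (le_of_eq hx))

theorem IsDense.top : IsDense (⊤ : A) := neg_top

theorem IsDense.mul {x y : A} (hx : IsDense x) (hy : IsDense y) : IsDense (x * y) := by
  have h : neg (x * y) * x ≤ neg y := by
    rw [le_neg_iff, mul_assoc, mul_comm, mul_neg]
  rw [hy, le_bot_iff, ← le_neg_iff, hx, le_bot_iff] at h
  exact h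

end BddResLattice

open BddResLattice in
/-- The Boolean skeleton `B(A)`. -/
def BSkel (A : Type u) [BddResLattice A] : Type u := {a : A // IsBool a}

open BddResLattice in
/-- The algebra of dense elements `D(A)`. -/
def DAlg (A : Type u) [BddResLattice A] : Type u := {x : A // IsDense x}

namespace BSkel

open BddResLattice

variable {A : Type u} [BddResLattice A]

instance : Lattice (BSkel A) := Subtype.lattice (fun _ _ => IsBool.sup) (fun _ _ => IsBool.inf)

/-- `B(A)` is a Boolean algebra with the order of `A` and the complement `¬`. -/
instance : BooleanAlgebra (BSkel A) where
  le_sup_inf a b c := by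
    change (a.1 ⊔ b.1) ⊓ (a.1 ⊔ c.1) ≤ a.1 ⊔ b.1 ⊓ c.1
    rw [(a.2.sup b.2).inf_sup, inf_comm _ c.1, c.2.inf_sup, inf_comm c.1 b.1]
    exact sup_le (inf_le_right.trans le_sup_left)
      (sup_le (inf_le_right.trans le_sup_left) le_sup_right)
  compl a := ⟨neg a.1, a.2.neg⟩
  top := ⟨⊤, IsBool.top⟩
  bot := ⟨⊥, IsBool.bot⟩
  inf_compl_le_bot a := (le_of_eq a.2.2 : a.1 ⊓ neg a.1 ≤ ⊥)
  top_le_sup_compl a := (le_of_eq a.2.1.symm : ⊤ ≤ a.1 ⊔ neg a.1)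
  le_top a := (le_top : a.1 ≤ ⊤)
  bot_le a := (bot_le : ⊥ ≤ a.1)

end BSkel

namespace DAlg

open BddResLattice ResLattice

variable {A : Type u} [BddResLattice A]

instance : Lattice (DAlg A) :=
  Subtype.lattice (fun _ _ hx _ => hx.of_le le_sup_left)
    (fun _ _ hx hy => (hx.mul hy).of_le (le_inf (mul_le_left' _ _) (mul_le_right' _ _)))

instance : OrderTop (DAlg A) where
  top := ⟨⊤, IsDense.top⟩
  le_top x := (le_top : x.1 ≤ ⊤)

/-- `D(A)` is a residuated lattice with the operations of `A`. -/
instance : ResLattice (DAlg A) where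
  mul x y := ⟨x.1 * y.1, x.2.mul y.2⟩
  one := ⊤
  mul_assoc x y z := Subtype.ext (mul_assoc x.1 y.1 z.1)
  mul_comm x y := Subtype.ext (mul_comm x.1 y.1)
  one_mul x := Subtype.ext (top_mul' x.1)
  mul_one x := Subtype.ext (mul_top' x.1)
  himp x y := ⟨x.1 ⇨ y.1, y.2.of_le ((mul_le_iff _ _ _).1 (mul_le_left' _ _))⟩
  one_eq_top := rfl
  mul_le_iff x y z := mul_le_iff x.1 y.1 z.1

end DAlg

/-! ### Implicative filters -/

/-- Implicative filters of a residuated lattice. -/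
@[ext]
structure IFilter (D : Type u) [ResLattice D] where
  carrier : Set D
  top_mem : ⊤ ∈ carrier
  mp_mem : ∀ x y, x ∈ carrier → x ⇨ y ∈ carrier → y ∈ carrier

namespace IFilter

open ResLattice

variable {D : Type u} [ResLattice D]

instance : SetLike (IFilter D) D := ⟨carrier, fun _ _ => IFilter.ext⟩

/-- Implicative filters are ordered by inclusion. -/
instance : PartialOrder (IFilter D) := PartialOrder.lift carrier fun _ _ => IFilter.ext

instance : InfSet (IFilter D) where
  sInf s :=
    { carrier := {x | ∀ F ∈ s, x ∈ F}
      top_mem := fun F _ => F.top_mem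
      mp_mem := fun x y hx hxy F hF => F.mp_mem x y (hx F hF) (hxy F hF) }

/-- In this lattice the meet is the intersection, the join is the implicative filter generated by
the union, the bottom is `{⊤}` and the top is the whole algebra. -/
instance : CompleteLattice (IFilter D) :=
  { completeLatticeOfInf (IFilter D) (fun _ =>
      ⟨fun _ hF _ hx => hx _ hF, fun _ hG _ hx _ hF => hG hF hx⟩) with
    inf := fun F G =>
      { carrier := {x | x ∈ F ∧ x ∈ G}
        top_mem := ⟨F.top_mem, G.top_mem⟩
        mp_mem := fun x y hx hxy => ⟨F.mp_mem x y hx.1 hxy.1, G.mp_mem x y hx.2 hxy.2⟩ }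
    inf_le_left := fun _ _ _ hx => hx.1
    inf_le_right := fun _ _ _ hx => hx.2
    le_inf := fun _ _ _ h h' _ hx => ⟨h hx, h' hx⟩
    top := ⟨Set.univ, trivial, fun _ _ _ _ => trivial⟩
    le_top := fun _ _ _ => trivial
    bot := ⟨{⊤}, rfl, fun x y hx hxy => by
      rw [Set.mem_singleton_iff] at hx hxy ⊢
      rw [himp_top_iff, hx, top_le_iff] at hxy
      exact hxy⟩
    bot_le := fun F x hx => by
      rw [Set.mem_singleton_iff.1 hx]
      exact F.top_mem }

theorem le_iff {F G : IFilter D} : F ≤ G ↔ ∀ x, x ∈ F → x ∈ G := Iff.rfl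
theorem mem_inf {F G : IFilter D} {x : D} : x ∈ F ⊓ G ↔ x ∈ F ∧ x ∈ G := Iff.rfl
theorem mem_top (x : D) : x ∈ (⊤ : IFilter D) := trivial
theorem mem_bot {x : D} : x ∈ (⊥ : IFilter D) ↔ x = ⊤ := Iff.rfl

theorem mem_of_le (F : IFilter D) {x y : D} (hx : x ∈ F) (h : x ≤ y) : y ∈ F :=
  F.mp_mem x y hx (by rw [himp_top_iff.2 h]; exact F.top_mem)

theorem mul_mem (F : IFilter D) {x y : D} (hx : x ∈ F) (hy : y ∈ F) : x * y ∈ F :=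
  F.mp_mem y _ hy (F.mem_of_le hx ((mul_le_iff _ _ _).1 le_rfl))

theorem mem_sup_of {F G : IFilter D} {x y z : D} (hx : x ∈ F) (hy : y ∈ G) (h : x * y ≤ z) :
    z ∈ F ⊔ G :=
  (F ⊔ G).mem_of_le
    ((F ⊔ G).mul_mem ((le_sup_left : F ≤ F ⊔ G) hx) ((le_sup_right : G ≤ F ⊔ G) hy)) h

/-- The product of a family of implicative filters. -/
def pi {ι : Type v} {D : ι → Type u} [∀ i, ResLattice (D i)] (F : ∀ i, IFilter (D i)) :
    IFilter (∀ i, D i) where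
  carrier := {d | ∀ i, d i ∈ F i}
  top_mem i := (F i).top_mem
  mp_mem x y hx hxy i := (F i).mp_mem (x i) (y i) (hx i) (hxy i)

end IFilter

/-! ### Triples -/

/-- Triples `(B, D, φ)`: a Boolean algebra, a residuated lattice, and a bounded lattice
homomorphism from `B` to the lattice of implicative filters of `D`. -/
structure Triple : Type (u + 1) where
  B : Type u
  D : Type u
  [boolB : BooleanAlgebra B]
  [resD : ResLattice D]
  φ : BoundedLatticeHom B (IFilter D)

attribute [instance] Triple.boolB Triple.resD

namespace Triple

/-- Morphisms of triples. (A bounded lattice homomorphism between Boolean algebras is the same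
as a homomorphism of Boolean algebras.) -/
@[ext]
structure Hom (T₁ T₂ : Triple.{u}) where
  h : BoundedLatticeHom T₁.B T₂.B
  k : RLHom T₁.D T₂.D
  map_φ : ∀ a : T₁.B, ∀ d ∈ T₁.φ a, k.toFun d ∈ T₂.φ (h a)

/-- The category of triples, with componentwise composition. -/
instance : CategoryTheory.Category Triple.{u} where
  Hom := Hom
  id T := ⟨BoundedLatticeHom.id _,
    ⟨fun d => d, fun _ _ => rfl, fun _ _ => rfl, fun _ _ => rfl, fun _ _ => rfl, rfl⟩,
    fun _ _ hd => hd⟩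
  comp f g := ⟨g.h.comp f.h,
    { toFun := fun d => g.k.toFun (f.k.toFun d)
      map_mul := fun x y => by rw [f.k.map_mul, g.k.map_mul]
      map_himp := fun x y => by rw [f.k.map_himp, g.k.map_himp]
      map_sup := fun x y => by rw [f.k.map_sup, g.k.map_sup]
      map_inf := fun x y => by rw [f.k.map_inf, g.k.map_inf]
      map_top := by rw [f.k.map_top, g.k.map_top] },
    fun a d hd => g.map_φ _ _ (f.map_φ a d hd)⟩

end Triple

section TripleOf

open BddResLattice ResLattice

/-- `φ_A(a) = {x ∈ D(A) : x ≥ ¬ a}`. -/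
def phiFilter {A : Type u} [BddResLattice A] (a : BSkel A) : IFilter (DAlg A) where
  carrier := {x | neg a.1 ≤ x.1}
  top_mem := (le_top : neg a.1 ≤ ⊤)
  mp_mem x y hx hxy := by
    have h := mul_mono hx hxy
    rw [a.2.neg.mul_eq, inf_idem] at h
    exact h.trans (mul_himp_le x.1 y.1)

/-- The triple `(B(A), D(A), φ_A)` associated with `A`. -/
def tripleOf (A : Type u) [BddResLattice A] : Triple.{u} where
  B := BSkel A
  D := DAlg A
  φ :=
    { toFun := phiFilter
      map_sup' := fun a b => by
        apply le_antisymm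
        · intro d hd
          change neg (a.1 ⊔ b.1) ≤ d.1 at hd
          refine IFilter.mem_sup_of
            (x := ⟨d.1 ⊔ neg a.1, d.2.of_le le_sup_left⟩)
            (y := ⟨d.1 ⊔ neg b.1, d.2.of_le le_sup_left⟩)
            (le_sup_right : neg a.1 ≤ d.1 ⊔ neg a.1) (le_sup_right : neg b.1 ≤ d.1 ⊔ neg b.1) ?_
          change (d.1 ⊔ neg a.1) * (d.1 ⊔ neg b.1) ≤ d.1
          rw [sup_mul', mul_sup' (neg a.1), a.2.neg.mul_eq (neg b.1), ← BddResLattice.neg_sup]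
          exact sup_le (mul_le_left' _ _) (sup_le (mul_le_right' _ _) hd)
        · refine sup_le (fun d hd => ?_) (fun d hd => ?_)
          · exact (neg_anti (le_sup_left : a.1 ≤ a.1 ⊔ b.1)).trans hd
          · exact (neg_anti (le_sup_right : b.1 ≤ a.1 ⊔ b.1)).trans hd
      map_inf' := fun a b => by
        ext d
        change neg (a.1 ⊓ b.1) ≤ d.1 ↔ neg a.1 ≤ d.1 ∧ neg b.1 ≤ d.1
        rw [a.2.neg_inf b.2, sup_le_iff]
      map_top' := by
        ext d
        change neg (⊤ : A) ≤ d.1 ↔ True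
        simp [neg_top]
      map_bot' := by
        ext d
        change neg (⊥ : A) ≤ d.1 ↔ d = ⊤
        rw [neg_bot, top_le_iff]
        exact ⟨fun h => Subtype.ext h, fun h => congrArg Subtype.val h⟩ }

end TripleOf

/-! ### Terms and identities -/

/-- Terms in the language of residuated lattices, with variables in `X`. -/
inductive RTerm (X : Type u) : Type u
  | var (x : X)
  | top
  | mul (s t : RTerm X)
  | himp (s t : RTerm X)
  | sup (s t : RTerm X)
  | inf (s t : RTerm X)

/-- Terms in the language of bounded residuated lattices, with variables in `X`. -/
inductive BTerm (X : Type u) : Type u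
  | var (x : X)
  | top
  | bot
  | mul (s t : BTerm X)
  | himp (s t : BTerm X)
  | sup (s t : BTerm X)
  | inf (s t : BTerm X)

/-- The value of a term under an assignment of the variables. -/
def RTerm.eval {X : Type u} {A : Type v} [ResLattice A] (w : X → A) : RTerm X → A
  | var x => w x
  | top => ⊤
  | mul s t => s.eval w * t.eval w
  | himp s t => s.eval w ⇨ t.eval w
  | sup s t => s.eval w ⊔ t.eval w
  | inf s t => s.eval w ⊓ t.eval w

/-- The value of a term under an assignment of the variables. -/
def BTerm.eval {X : Type u} {A : Type v} [BddResLattice A] (w : X → A) : BTerm X → A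
  | var x => w x
  | top => ⊤
  | bot => ⊥
  | mul s t => s.eval w * t.eval w
  | himp s t => s.eval w ⇨ t.eval w
  | sup s t => s.eval w ⊔ t.eval w
  | inf s t => s.eval w ⊓ t.eval w

/-! ### Varieties of Stonean residuated lattices -/

open BddResLattice in
/-- Stonean residuated lattices. -/
def IsStonean (A : Type u) [BddResLattice A] : Prop := ∀ x : A, neg x ⊔ neg (neg x) = ⊤

open BddResLattice in
/-- Boolean algebras, as bounded residuated lattices: all elements are complemented. (The product
is then the meet, and `x ⇨ y = ¬ x ⊔ y`.) -/
def IsBooleanRL (A : Type u) [BddResLattice A] : Prop := ∀ a : A, IsBool a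

/-- A variety of Stonean residuated lattices, given by a set of identities (between terms in
countably many variables) that are imposed on Stonean residuated lattices. -/
structure SRLVariety where
  identities : Set (BTerm ℕ × BTerm ℕ)

namespace SRLVariety

/-- Membership in the variety `V`. -/
def Mem (V : SRLVariety) (A : Type u) [BddResLattice A] : Prop :=
  IsStonean A ∧ ∀ e ∈ V.identities, ∀ w : ℕ → A, e.1.eval w = e.2.eval w

/-- Membership in `V*`, the class of the residuated lattices `A` with `S(A) ∈ V`. -/
def StarMem (V : SRLVariety) (A : Type u) [ResLattice A] : Prop := V.Mem (SExt A)

/-- `V` properly contains the variety of Boolean algebras. -/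
def ProperlyContainsBoolean (V : SRLVariety) : Prop :=
  (∀ (A : Type) [BddResLattice A], IsBooleanRL A → V.Mem A) ∧
    ∃ (A : Type) (_ : BddResLattice A), V.Mem A ∧ ¬ IsBooleanRL A

/-! ### Free algebras -/

/-- Two terms are identified when they have the same value in all algebras of `V`, under all
assignments. -/
def setoid (V : SRLVariety) (X : Type u) : Setoid (BTerm X) where
  r s t := ∀ (A : Type u) [BddResLattice A], V.Mem A → ∀ w : X → A, s.eval w = t.eval w
  iseqv := ⟨fun _ _ _ _ _ => rfl, fun h A _ hA w => (h A hA w).symm,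
    fun h h' A _ hA w => (h A hA w).trans (h' A hA w)⟩

/-- Two terms are identified when they have the same value in all algebras of `V*`, under all
assignments. -/
def starSetoid (V : SRLVariety) (X : Type u) : Setoid (RTerm X) where
  r s t := ∀ (A : Type u) [ResLattice A], V.StarMem A → ∀ w : X → A, s.eval w = t.eval w
  iseqv := ⟨fun _ _ _ _ _ => rfl, fun h A _ hA w => (h A hA w).symm,
    fun h h' A _ hA w => (h A hA w).trans (h' A hA w)⟩

/-- The free algebra of `V` over the set `X` of generators: the term algebra modulo the identities
that hold in `V`. -/
def Free (V : SRLVariety) (X : Type u) : Type u := Quotient (V.setoid X)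

/-- The free algebra of `V*` over the set `X` of generators: the term algebra modulo the identities
that hold in `V*`. -/
def FreeStar (V : SRLVariety) (X : Type u) : Type u := Quotient (V.starSetoid X)

namespace Free

variable (V : SRLVariety) (X : Type u)

/-- The class of a term. -/
def mk {V : SRLVariety} {X : Type u} (t : BTerm X) : V.Free X := Quotient.mk (V.setoid X) t

instance : Max (V.Free X) :=
  ⟨Quotient.map₂ BTerm.sup fun _ _ h _ _ h' A _ hA w =>
    congrArg₂ (· ⊔ ·) (h A hA w) (h' A hA w)⟩

instance : Min (V.Free X) :=
  ⟨Quotient.map₂ BTerm.inf fun _ _ h _ _ h' A _ hA w =>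
    congrArg₂ (· ⊓ ·) (h A hA w) (h' A hA w)⟩

instance : Mul (V.Free X) :=
  ⟨Quotient.map₂ BTerm.mul fun _ _ h _ _ h' A _ hA w =>
    congrArg₂ (· * ·) (h A hA w) (h' A hA w)⟩

instance : HImp (V.Free X) :=
  ⟨Quotient.map₂ BTerm.himp fun _ _ h _ _ h' A _ hA w =>
    congrArg₂ (· ⇨ ·) (h A hA w) (h' A hA w)⟩

instance : Lattice (V.Free X) :=
  Lattice.mk'
    (fun a b => Quotient.inductionOn₂ a b fun _ _ => Quotient.sound fun _ _ _ _ => sup_comm _ _)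
    (fun a b c => Quotient.inductionOn₃ a b c fun _ _ _ =>
      Quotient.sound fun _ _ _ _ => sup_assoc _ _ _)
    (fun a b => Quotient.inductionOn₂ a b fun _ _ => Quotient.sound fun _ _ _ _ => inf_comm _ _)
    (fun a b c => Quotient.inductionOn₃ a b c fun _ _ _ =>
      Quotient.sound fun _ _ _ _ => inf_assoc _ _ _)
    (fun a b => Quotient.inductionOn₂ a b fun _ _ => Quotient.sound fun _ _ _ _ => sup_inf_self)
    (fun a b => Quotient.inductionOn₂ a b fun _ _ => Quotient.sound fun _ _ _ _ => inf_sup_self)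

variable {V X}

theorem mk_le_mk {s t : BTerm X} : (mk s : V.Free X) ≤ mk t ↔
    ∀ (A : Type u) [BddResLattice A], V.Mem A → ∀ w : X → A, s.eval w ≤ t.eval w := by
  rw [← sup_eq_right]
  change (mk (s.sup t) : V.Free X) = mk t ↔ _
  refine Quotient.eq.trans ?_
  exact forall₄_congr fun A _ hA w => sup_eq_right

variable (V X)

instance : BddResLattice (V.Free X) where
  top := mk BTerm.top
  le_top a := Quotient.inductionOn a fun _ => mk_le_mk.2 fun _ _ _ _ => le_top
  bot := mk BTerm.bot
  bot_le a := Quotient.inductionOn a fun _ => mk_le_mk.2 fun _ _ _ _ => bot_le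
  one := mk BTerm.top
  mul_assoc a b c := Quotient.inductionOn₃ a b c fun _ _ _ =>
    Quotient.sound fun _ _ _ _ => mul_assoc _ _ _
  mul_comm a b := Quotient.inductionOn₂ a b fun _ _ =>
    Quotient.sound fun _ _ _ _ => mul_comm _ _
  one_mul a := Quotient.inductionOn a fun _ =>
    Quotient.sound fun _ _ _ _ => ResLattice.top_mul' _
  mul_one a := Quotient.inductionOn a fun _ =>
    Quotient.sound fun _ _ _ _ => ResLattice.mul_top' _
  one_eq_top := rfl
  mul_le_iff a b c := Quotient.inductionOn₃ a b c fun _ _ _ =>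
    ⟨fun h => mk_le_mk.2 fun A _ hA w =>
        (ResLattice.mul_le_iff _ _ _).1 (mk_le_mk.1 h A hA w),
      fun h => mk_le_mk.2 fun A _ hA w =>
        (ResLattice.mul_le_iff _ _ _).2 (mk_le_mk.1 h A hA w)⟩

end Free

namespace FreeStar

variable (V : SRLVariety) (X : Type u)

/-- The class of a term. -/
def mk {V : SRLVariety} {X : Type u} (t : RTerm X) : V.FreeStar X :=
  Quotient.mk (V.starSetoid X) t

instance : Max (V.FreeStar X) :=
  ⟨Quotient.map₂ RTerm.sup fun _ _ h _ _ h' A _ hA w =>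
    congrArg₂ (· ⊔ ·) (h A hA w) (h' A hA w)⟩

instance : Min (V.FreeStar X) :=
  ⟨Quotient.map₂ RTerm.inf fun _ _ h _ _ h' A _ hA w =>
    congrArg₂ (· ⊓ ·) (h A hA w) (h' A hA w)⟩

instance : Mul (V.FreeStar X) :=
  ⟨Quotient.map₂ RTerm.mul fun _ _ h _ _ h' A _ hA w =>
    congrArg₂ (· * ·) (h A hA w) (h' A hA w)⟩

instance : HImp (V.FreeStar X) :=
  ⟨Quotient.map₂ RTerm.himp fun _ _ h _ _ h' A _ hA w =>
    congrArg₂ (· ⇨ ·) (h A hA w) (h' A hA w)⟩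

instance : Lattice (V.FreeStar X) :=
  Lattice.mk'
    (fun a b => Quotient.inductionOn₂ a b fun _ _ => Quotient.sound fun _ _ _ _ => sup_comm _ _)
    (fun a b c => Quotient.inductionOn₃ a b c fun _ _ _ =>
      Quotient.sound fun _ _ _ _ => sup_assoc _ _ _)
    (fun a b => Quotient.inductionOn₂ a b fun _ _ => Quotient.sound fun _ _ _ _ => inf_comm _ _)
    (fun a b c => Quotient.inductionOn₃ a b c fun _ _ _ =>
      Quotient.sound fun _ _ _ _ => inf_assoc _ _ _)
    (fun a b => Quotient.inductionOn₂ a b fun _ _ => Quotient.sound fun _ _ _ _ => sup_inf_self)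
    (fun a b => Quotient.inductionOn₂ a b fun _ _ => Quotient.sound fun _ _ _ _ => inf_sup_self)

variable {V X}

theorem mk_le_mk {s t : RTerm X} : (mk s : V.FreeStar X) ≤ mk t ↔
    ∀ (A : Type u) [ResLattice A], V.StarMem A → ∀ w : X → A, s.eval w ≤ t.eval w := by
  rw [← sup_eq_right]
  change (mk (s.sup t) : V.FreeStar X) = mk t ↔ _
  refine Quotient.eq.trans ?_
  exact forall₄_congr fun A _ hA w => sup_eq_right

variable (V X)

instance : ResLattice (V.FreeStar X) where
  top := mk RTerm.top
  le_top a := Quotient.inductionOn a fun _ => mk_le_mk.2 fun _ _ _ _ => le_top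
  one := mk RTerm.top
  mul_assoc a b c := Quotient.inductionOn₃ a b c fun _ _ _ =>
    Quotient.sound fun _ _ _ _ => mul_assoc _ _ _
  mul_comm a b := Quotient.inductionOn₂ a b fun _ _ =>
    Quotient.sound fun _ _ _ _ => mul_comm _ _
  one_mul a := Quotient.inductionOn a fun _ =>
    Quotient.sound fun _ _ _ _ => ResLattice.top_mul' _
  mul_one a := Quotient.inductionOn a fun _ =>
    Quotient.sound fun _ _ _ _ => ResLattice.mul_top' _
  one_eq_top := rfl
  mul_le_iff a b c := Quotient.inductionOn₃ a b c fun _ _ _ =>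
    ⟨fun h => mk_le_mk.2 fun A _ hA w =>
        (ResLattice.mul_le_iff _ _ _).1 (mk_le_mk.1 h A hA w),
      fun h => mk_le_mk.2 fun A _ hA w =>
        (ResLattice.mul_le_iff _ _ _).2 (mk_le_mk.1 h A hA w)⟩

end FreeStar

end SRLVariety

/-! ### The universal properties -/

theorem RLHom.map_eval {X : Type*} {A B : Type*} [ResLattice A] [ResLattice B] (f : RLHom A B)
    (w : X → A) (t : RTerm X) : f.toFun (t.eval w) = t.eval (fun x => f.toFun (w x)) := by
  induction t with
  | var x => rfl
  | top => exact f.map_top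
  | mul s t hs ht => simp only [RTerm.eval, f.map_mul, hs, ht]
  | himp s t hs ht => simp only [RTerm.eval, f.map_himp, hs, ht]
  | sup s t hs ht => simp only [RTerm.eval, f.map_sup, hs, ht]
  | inf s t hs ht => simp only [RTerm.eval, f.map_inf, hs, ht]

theorem BRLHom.map_eval {X : Type*} {A B : Type*} [BddResLattice A] [BddResLattice B]
    (f : BRLHom A B) (w : X → A) (t : BTerm X) :
    f.toFun (t.eval w) = t.eval (fun x => f.toFun (w x)) := by
  induction t with
  | var x => rfl
  | top => exact f.map_top
  | bot => exact f.map_bot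
  | mul s t hs ht => simp only [BTerm.eval, f.map_mul, hs, ht]
  | himp s t hs ht => simp only [BTerm.eval, f.map_himp, hs, ht]
  | sup s t hs ht => simp only [BTerm.eval, f.map_sup, hs, ht]
  | inf s t hs ht => simp only [BTerm.eval, f.map_inf, hs, ht]

/-- The extension `S(h)` of a homomorphism `h`. -/
def SExt.map {A : Type u} {B : Type v} [ResLattice A] [ResLattice B] (h : RLHom A B) :
    BRLHom (SExt A) (SExt B) where
  toFun := SExt.lift SExt.o fun a => SExt.elt (h.toFun a)
  map_mul x y := by
    induction x using SExt.cases <;> induction y using SExt.cases <;> simp [h.map_mul]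
  map_himp x y := by
    induction x using SExt.cases <;> induction y using SExt.cases <;>
      simp [h.map_himp, h.map_top, SExt.top_eq]
  map_sup x y := by
    induction x using SExt.cases <;> induction y using SExt.cases <;>
      simp [h.map_sup, ← SExt.elt_sup]
  map_inf x y := by
    induction x using SExt.cases <;> induction y using SExt.cases <;>
      simp [h.map_inf, ← SExt.elt_inf]
  map_top := by simp [SExt.top_eq, h.map_top]
  map_bot := rfl

namespace SRLVariety

variable (V : SRLVariety) {X : Type u}

/-- An algebra is in `V` if homomorphisms into members of `V` separate its points. -/
theorem mem_of_separates {F : Type u} [BddResLattice F]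
    (h : ∀ x y : F, (∀ (A : Type u) [BddResLattice A], V.Mem A → ∀ f : BRLHom F A,
      f.toFun x = f.toFun y) → x = y) : V.Mem F := by
  refine ⟨fun x => h _ _ fun A _ hA f => ?_, fun e he w => h _ _ fun A _ hA f => ?_⟩
  · simp only [BddResLattice.neg, f.map_sup, f.map_himp, f.map_bot, f.map_top]
    exact hA.1 _
  · rw [f.map_eval, f.map_eval]
    exact hA.2 e he _

/-- The homomorphism from the free algebra of `V` that extends an assignment. -/
def Free.lift {V : SRLVariety} {A : Type u} [BddResLattice A] (hA : V.Mem A) (w : X → A) :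
    BRLHom (V.Free X) A where
  toFun := Quotient.lift (BTerm.eval w) fun _ _ h => h A hA w
  map_mul x y := Quotient.inductionOn₂ x y fun _ _ => rfl
  map_himp x y := Quotient.inductionOn₂ x y fun _ _ => rfl
  map_sup x y := Quotient.inductionOn₂ x y fun _ _ => rfl
  map_inf x y := Quotient.inductionOn₂ x y fun _ _ => rfl
  map_top := rfl
  map_bot := rfl

theorem Free.mem : V.Mem (V.Free X) :=
  V.mem_of_separates fun x y => Quotient.inductionOn₂ x y fun _ _ h =>
    Quotient.sound fun A _ hA w => h A hA (Free.lift hA w)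

theorem Free.mk_eval (t : BTerm X) : t.eval (fun x => (mk (BTerm.var x) : V.Free X)) = mk t := by
  induction t with
  | var x => rfl
  | top => rfl
  | bot => rfl
  | mul s t hs ht => simp only [BTerm.eval, hs, ht]; rfl
  | himp s t hs ht => simp only [BTerm.eval, hs, ht]; rfl
  | sup s t hs ht => simp only [BTerm.eval, hs, ht]; rfl
  | inf s t hs ht => simp only [BTerm.eval, hs, ht]; rfl

/-- `V.Free X` is free over `X` in `V`. -/
theorem Free.existsUnique_hom {A : Type u} [BddResLattice A] (hA : V.Mem A) (w : X → A) :
    ∃! f : BRLHom (V.Free X) A, ∀ x, f.toFun (mk (BTerm.var x)) = w x := by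
  refine ⟨Free.lift hA w, fun _ => rfl, fun f hf => BRLHom.ext (funext fun a => ?_)⟩
  induction a using Quotient.inductionOn with
  | h t =>
    change f.toFun (mk t) = t.eval w
    rw [← Free.mk_eval, f.map_eval]
    simp only [hf]

/-- The homomorphism from the free algebra of `V*` that extends an assignment. -/
def FreeStar.lift {V : SRLVariety} {A : Type u} [ResLattice A] (hA : V.StarMem A) (w : X → A) :
    RLHom (V.FreeStar X) A where
  toFun := Quotient.lift (RTerm.eval w) fun _ _ h => h A hA w
  map_mul x y := Quotient.inductionOn₂ x y fun _ _ => rfl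
  map_himp x y := Quotient.inductionOn₂ x y fun _ _ => rfl
  map_sup x y := Quotient.inductionOn₂ x y fun _ _ => rfl
  map_inf x y := Quotient.inductionOn₂ x y fun _ _ => rfl
  map_top := rfl

/-- `V.FreeStar X` is in `V*`, unless `V*` is empty (that is, `V` is trivial). -/
theorem FreeStar.starMem (hV : ∃ (A : Type u) (_ : ResLattice A), V.StarMem A) :
    V.StarMem (V.FreeStar X) := by
  obtain ⟨A₀, _, h₀⟩ := hV
  refine V.mem_of_separates fun x y h => ?_
  have key : ∀ (A : Type u) [ResLattice A] (hA : V.StarMem A) (w : X → A),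
      (SExt.map (FreeStar.lift hA w)).toFun x = (SExt.map (FreeStar.lift hA w)).toFun y :=
    fun A _ hA w => h _ hA _
  induction x using SExt.cases with
  | ho =>
    induction y using SExt.cases with
    | ho => rfl
    | he b => exact absurd (key A₀ h₀ fun _ => ⊤).symm (SExt.elt_ne_o _)
  | he a =>
    induction y using SExt.cases with
    | ho => exact absurd (key A₀ h₀ fun _ => ⊤) (SExt.elt_ne_o _)
    | he b =>
      congr 1
      induction a using Quotient.inductionOn
      induction b using Quotient.inductionOn
      exact Quotient.sound fun A _ hA w => SExt.elt_injective (key A hA w)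

theorem FreeStar.mk_eval (t : RTerm X) :
    t.eval (fun x => (mk (RTerm.var x) : V.FreeStar X)) = mk t := by
  induction t with
  | var x => rfl
  | top => rfl
  | mul s t hs ht => simp only [RTerm.eval, hs, ht]; rfl
  | himp s t hs ht => simp only [RTerm.eval, hs, ht]; rfl
  | sup s t hs ht => simp only [RTerm.eval, hs, ht]; rfl
  | inf s t hs ht => simp only [RTerm.eval, hs, ht]; rfl

/-- `V.FreeStar X` is free over `X` in `V*`. -/
theorem FreeStar.existsUnique_hom {A : Type u} [ResLattice A] (hA : V.StarMem A) (w : X → A) :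
    ∃! f : RLHom (V.FreeStar X) A, ∀ x, f.toFun (mk (RTerm.var x)) = w x := by
  refine ⟨FreeStar.lift hA w, fun _ => rfl, fun f hf => RLHom.ext (funext fun a => ?_)⟩
  induction a using Quotient.inductionOn with
  | h t =>
    change f.toFun (mk t) = t.eval w
    rw [← FreeStar.mk_eval, f.map_eval]
    simp only [hf]

end SRLVariety

/-! ### The explicit triple -/

/-- `{⊤}` for `b = 0` and the whole algebra for `b = 1`. -/
def trivialOrWhole (D : Type u) [ResLattice D] (b : Bool) : IFilter D := if b then ⊤ else ⊥

/-- The triple `(𝐁^ι, ∏ j, D j, φ)`, with `𝐁` the two-element Boolean algebra and `φ(b)` the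
product over `j` of the filters that are `{⊤}` for `b j = 0` and `D j` for `b j = 1`. -/
def coordinateTriple (ι : Type) (D : ι → Type) [∀ j, ResLattice (D j)] : Triple.{0} where
  B := ι → Bool
  D := ∀ j, D j
  φ :=
    { toFun := fun b => IFilter.pi fun j => trivialOrWhole (D j) (b j)
      map_sup' := fun b c => by
        have mono : ∀ b c : ι → Bool, b ≤ c → (IFilter.pi fun j => trivialOrWhole (D j) (b j)) ≤
            IFilter.pi fun j => trivialOrWhole (D j) (c j) := by
          intro b c hbc d hd j
          have h1 := hbc j
          have h2 : d j ∈ trivialOrWhole (D j) (b j) := hd j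
          change d j ∈ trivialOrWhole (D j) (c j)
          cases hb : b j <;> cases hc : c j <;> rw [hb, hc] at h1 <;> rw [hb] at h2
          · exact h2
          · trivial
          · exact absurd (h1 rfl) Bool.false_ne_true
          · trivial
        apply le_antisymm
        · intro d hd
          refine IFilter.mem_sup_of (x := fun j => if b j then d j else ⊤)
            (y := fun j => if b j then ⊤ else d j) (fun j => ?_) (fun j => ?_) (fun j => ?_)
          · cases h : b j <;> simp [h, trivialOrWhole, IFilter.mem_top, IFilter.mem_bot]
          · have h2 : d j ∈ trivialOrWhole (D j) (b j ⊔ c j) := hd j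
            cases h : b j <;> cases h' : c j <;>
              simp_all [trivialOrWhole, IFilter.mem_top, IFilter.mem_bot]
          · cases h : b j <;> simp [h, ResLattice.top_mul', ResLattice.mul_top']
        · exact sup_le (mono _ _ le_sup_left) (mono _ _ le_sup_right)
      map_inf' := fun b c => by
        ext d
        change (∀ j, d j ∈ trivialOrWhole (D j) (b j ⊓ c j)) ↔
          (∀ j, d j ∈ trivialOrWhole (D j) (b j)) ∧ ∀ j, d j ∈ trivialOrWhole (D j) (c j)
        rw [← forall_and]
        refine forall_congr' fun j => ?_
        cases b j <;> cases c j <;> simp [trivialOrWhole, IFilter.mem_top, IFilter.mem_bot]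
      map_top' := by
        ext d
        exact ⟨fun _ => trivial, fun _ j => trivial⟩
      map_bot' := by
        ext d
        exact ⟨fun h => funext fun j => h j, fun h j => congrFun h j⟩ }

/-- `k_j = min {k : ∑_{l=0}^k (n choose l) ≥ j}` for `1 ≤ j ≤ 2^n`. -/
noncomputable def kIndex (n j : ℕ) : ℕ :=
  sInf {k : ℕ | j ≤ ∑ l ∈ Finset.range (k + 1), n.choose l}

/-!
Write `F` for the free algebra of `V` over a finite set `X` of generators `x`. In a Stonean
residuated lattice all the negations are Boolean elements, so every `I ⊆ X` gives a Boolean element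
`a_I`, the product of the `¬¬x` for `x ∈ I` and of the `¬x` for `x ∉ I` (`BddResLattice.atom`), and
these elements form a partition of unity. On the part of `F` below `a_I` the generators in `I` are
dense and the other ones are `⊥`, and an algebra generated by dense elements has the form `S(D)`;
this part is therefore the free algebra `S(Free_{V*}(I))`.

Precisely, the universal property of `F` gives homomorphisms `F → S(Free_{V*}(I))` that fix the
generators in `I` and send the other ones to the new bottom (`SRLVariety.coord`). Jointly they are
an isomorphism onto the product over all `I` (`SRLVariety.freeDecomposition`).

* They separate points (`SRLVariety.eval_eq_of_coord_eq`). Let `w` be an assignment in a nontrivial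
  algebra `A` of `V`. Modulo the congruence of `a_I`, it agrees with the assignment that is
  `w x ⊔ ¬a_I` for `x ∈ I`, which is dense, and `⊥` for `x ∉ I`. This one takes its values in the
  subalgebra `S(D(A))` of `A` (`DAlg.sExtHom`), so that values of terms under it are determined by
  their images in `S(Free_{V*}(I))`. Elements that agree modulo all the `a_I` are equal
  (`BddResLattice.eq_of_atom_mul_eq`).
* They are jointly surjective, because each of them is surjective and the `a_I` are mapped to the
  unit vectors of the product.

There are `n.choose k` subsets of cardinality `k`, and renaming generators and reindexing gives the
stated products. An isomorphism of algebras induces one of their triples (`BRLIso.triple`), and in a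
product of algebras `S(D j)` the Boolean elements are the families of bottoms and tops, the dense
elements are the families of old elements, and the filters are computed coordinatewise
(`SExt.coordinateTripleIso`). About `V` only this is used: it contains the two-element Boolean
algebra, which is `S` of the trivial algebra, so that `V*` is nonempty
(`SRLVariety.exists_starMem`).
-/

/-! ### Homomorphisms and isomorphisms -/

namespace RLHom

variable {A : Type u} {B : Type v} [ResLattice A] [ResLattice B]

/-- The underlying homomorphism of monoids. -/
def toMonoidHom (f : RLHom A B) : A →* B where
  toFun := f.toFun
  map_one' := by rw [ResLattice.one_eq_top, f.map_top, ResLattice.one_eq_top]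
  map_mul' := f.map_mul

theorem map_prod (f : RLHom A B) {ι : Type*} (s : Finset ι) (x : ι → A) :
    f.toFun (∏ i ∈ s, x i) = ∏ i ∈ s, f.toFun (x i) :=
  _root_.map_prod f.toMonoidHom x s

theorem monotone (f : RLHom A B) : Monotone f.toFun := fun x y h => by
  rw [← sup_eq_right, ← f.map_sup, sup_eq_right.2 h]

end RLHom

theorem BRLHom.map_neg {A : Type u} {B : Type v} [BddResLattice A] [BddResLattice B]
    (f : BRLHom A B) (x : A) :
    f.toFun (BddResLattice.neg x) = BddResLattice.neg (f.toFun x) := by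
  rw [BddResLattice.neg, f.map_himp, f.map_bot, BddResLattice.neg]

namespace RLIso

/-- The inverse isomorphism. -/
noncomputable def symm {A : Type u} {B : Type v} [ResLattice A] [ResLattice B] (f : RLIso A B) :
    RLIso B A where
  toFun := (Equiv.ofBijective f.toFun f.bijective).symm
  map_mul x y := f.bijective.1 <| by simp [f.map_mul, Equiv.ofBijective_apply_symm_apply f.toFun]
  map_himp x y := f.bijective.1 <| by simp [f.map_himp, Equiv.ofBijective_apply_symm_apply f.toFun]
  map_sup x y := f.bijective.1 <| by simp [f.map_sup, Equiv.ofBijective_apply_symm_apply f.toFun]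
  map_inf x y := f.bijective.1 <| by simp [f.map_inf, Equiv.ofBijective_apply_symm_apply f.toFun]
  map_top := f.bijective.1 <| by simp [f.map_top, Equiv.ofBijective_apply_symm_apply f.toFun]
  bijective := (Equiv.ofBijective f.toFun f.bijective).symm.bijective

theorem apply_symm_apply {A : Type u} {B : Type v} [ResLattice A] [ResLattice B] (f : RLIso A B)
    (b : B) : f.toFun (f.symm.toFun b) = b :=
  Equiv.ofBijective_apply_symm_apply f.toFun f.bijective b

theorem symm_apply_apply {A : Type u} {B : Type v} [ResLattice A] [ResLattice B] (f : RLIso A B)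
    (a : A) : f.symm.toFun (f.toFun a) = a :=
  Equiv.ofBijective_symm_apply_apply f.toFun f.bijective a

/-- The composition of two isomorphisms. -/
def trans {A B C : Type*} [ResLattice A] [ResLattice B] [ResLattice C] (f : RLIso A B)
    (g : RLIso B C) : RLIso A C where
  toFun := g.toFun ∘ f.toFun
  map_mul x y := by simp [f.map_mul, g.map_mul]
  map_himp x y := by simp [f.map_himp, g.map_himp]
  map_sup x y := by simp [f.map_sup, g.map_sup]
  map_inf x y := by simp [f.map_inf, g.map_inf]
  map_top := by simp [f.map_top, g.map_top]
  bijective := g.bijective.comp f.bijective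

/-- An isomorphism of residuated lattices between bounded ones preserves the least element. -/
def toBRLIso {A B : Type*} [BddResLattice A] [BddResLattice B] (f : RLIso A B) : BRLIso A B where
  toRLHom := f.toRLHom
  map_bot := by
    obtain ⟨x, hx⟩ := f.bijective.2 ⊥
    exact le_bot_iff.1 (hx ▸ f.monotone bot_le)
  bijective := f.bijective

/-- Products over equivalent index sets with isomorphic factors are isomorphic. -/
noncomputable def piCongr {ι κ : Type*} {F : ι → Type u} {G : κ → Type v} [∀ i, ResLattice (F i)]
    [∀ k, ResLattice (G k)] (e : κ ≃ ι) (f : ∀ k, RLIso (F (e k)) (G k)) :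
    RLIso (∀ i, F i) (∀ k, G k) where
  toFun d k := (f k).toFun (d (e k))
  map_mul x y := funext fun k => (f k).map_mul _ _
  map_himp x y := funext fun k => (f k).map_himp _ _
  map_sup x y := funext fun k => (f k).map_sup _ _
  map_inf x y := funext fun k => (f k).map_inf _ _
  map_top := funext fun k => (f k).map_top
  bijective := by
    refine ⟨fun x y h => funext fun i => ?_, fun g => ?_⟩
    · obtain ⟨k, rfl⟩ := e.surjective i
      exact (f k).bijective.1 (congrFun h k)
    · choose c hc using fun k => (f k).bijective.2 (g k)
      refine ⟨Equiv.piCongrLeft F e c, funext fun k => ?_⟩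
      change (f k).toFun (Equiv.piCongrLeft F e c (e k)) = g k
      rw [Equiv.piCongrLeft_apply_apply, hc]

/-- A product over a sigma type is an iterated product. -/
def piCurry {ι : Type*} {κ : ι → Type*} {F : ι → Type u} [∀ i, ResLattice (F i)] :
    RLIso (∀ p : Σ i, κ i, F p.1) (∀ i, κ i → F i) where
  toFun d i j := d ⟨i, j⟩
  map_mul _ _ := rfl
  map_himp _ _ := rfl
  map_sup _ _ := rfl
  map_inf _ _ := rfl
  map_top := rfl
  bijective := (Equiv.piCurry fun i (_ : κ i) => F i).bijective

/-- `S` preserves isomorphisms. -/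
def sExt {A : Type u} {B : Type v} [ResLattice A] [ResLattice B] (f : RLIso A B) :
    RLIso (SExt A) (SExt B) where
  toRLHom := (SExt.map f.toRLHom).toRLHom
  bijective := by
    constructor
    · intro x y h
      induction x using SExt.cases with
      | ho =>
        induction y using SExt.cases with
        | ho => rfl
        | he b => exact absurd h.symm (SExt.elt_ne_o _)
      | he a =>
        induction y using SExt.cases with
        | ho => exact absurd h (SExt.elt_ne_o _)
        | he b => exact congrArg SExt.elt (f.bijective.1 (SExt.elt_injective h))
    · intro y
      induction y using SExt.cases with
      | ho => exact ⟨SExt.o, rfl⟩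
      | he b =>
        obtain ⟨a, rfl⟩ := f.bijective.2 b
        exact ⟨SExt.elt a, rfl⟩

end RLIso

/-! ### The subalgebra of the dense elements and the bottom -/

/-- The embedding of `S(D(A))` in `A` that sends the new element to `⊥`. -/
def DAlg.sExtHom (A : Type u) [BddResLattice A] : BRLHom (SExt (DAlg A)) A where
  toFun := SExt.lift ⊥ Subtype.val
  map_mul x y := by
    induction x using SExt.cases <;> induction y using SExt.cases
    · exact (le_bot_iff.1 (ResLattice.mul_le_left' _ _)).symm
    · exact (le_bot_iff.1 (ResLattice.mul_le_left' _ _)).symm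
    · exact (le_bot_iff.1 (ResLattice.mul_le_right' _ _)).symm
    · rfl
  map_himp x y := by
    induction x using SExt.cases with
    | ho => exact (ResLattice.himp_top_iff.2 bot_le).symm
    | he a =>
      induction y using SExt.cases with
      | ho => exact a.2.symm
      | he b => rfl
  map_sup x y := by
    induction x using SExt.cases <;> induction y using SExt.cases
    · exact (sup_idem _).symm
    · exact (bot_sup_eq _).symm
    · exact (sup_bot_eq _).symm
    · rfl
  map_inf x y := by
    induction x using SExt.cases <;> induction y using SExt.cases
    · exact (inf_idem _).symm
    · exact (bot_inf_eq _).symm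
    · exact (inf_bot_eq _).symm
    · rfl
  map_top := rfl
  map_bot := rfl

theorem DAlg.sExtHom_injective {A : Type u} [BddResLattice A] (hA : (⊤ : A) ≠ ⊥) :
    Function.Injective (DAlg.sExtHom A).toFun := by
  have hd (d : DAlg A) : d.1 ≠ ⊥ := fun h =>
    hA (BddResLattice.neg_bot.symm.trans ((congrArg BddResLattice.neg h.symm).trans d.2))
  intro x y h
  induction x using SExt.cases with
  | ho =>
    induction y using SExt.cases with
    | ho => rfl
    | he b => exact absurd (show ⊥ = b.1 from h).symm (hd b)
  | he a =>
    induction y using SExt.cases with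
    | ho => exact absurd (show a.1 = ⊥ from h) (hd a)
    | he b => exact congrArg SExt.elt (Subtype.ext h)

theorem SRLVariety.starMem_dAlg {V : SRLVariety} {A : Type u} [BddResLattice A] (hA : V.Mem A)
    (h : (⊤ : A) ≠ ⊥) : V.StarMem (DAlg A) :=
  V.mem_of_separates fun _ _ hxy => DAlg.sExtHom_injective h (hxy A hA _)

/-! ### Congruences given by Boolean elements -/

namespace BddResLattice

open ResLattice

variable {A : Type u} [BddResLattice A] {a x x' y y' : A}

theorem IsBool.mul (ha : IsBool a) (hx : IsBool x) : IsBool (a * x) := by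
  rw [ha.mul_eq]
  exact ha.inf hx

theorem IsBool.prod {ι : Type*} (s : Finset ι) (f : ι → A) (h : ∀ i ∈ s, IsBool (f i)) :
    IsBool (∏ i ∈ s, f i) :=
  Finset.prod_induction f IsBool (fun _ _ => IsBool.mul) (one_eq_top (A := A) ▸ IsBool.top) h

theorem IsBool.mul_self (ha : IsBool a) : a * a = a := by rw [ha.mul_eq, inf_idem]

theorem IsBool.congr_mul (ha : IsBool a) (hx : a * x = a * x') (hy : a * y = a * y') :
    a * (x * y) = a * (x' * y') := by
  have key (u v : A) : a * (u * v) = (a * u) * (a * v) := by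
    rw [mul_mul_mul_comm, ha.mul_self]
  rw [key, hx, hy, ← key]

theorem IsBool.congr_inf (ha : IsBool a) (hx : a * x = a * x') (hy : a * y = a * y') :
    a * (x ⊓ y) = a * (x' ⊓ y') := by
  simp only [ha.mul_eq] at *
  rw [inf_inf_distrib_left, hx, hy, ← inf_inf_distrib_left]

theorem IsBool.congr_himp (ha : IsBool a) (hx : a * x = a * x') (hy : a * y = a * y') :
    a * (x ⇨ y) = a * (x' ⇨ y') := by
  have key (u v : A) : a * (u ⇨ v) = a * ((a * u) ⇨ (a * v)) := by
    apply le_antisymm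
    · refine mul_mono le_rfl ((mul_le_iff _ _ _).1 ?_)
      rw [mul_left_comm]
      exact mul_mono le_rfl (himp_mul_le u v)
    · rw [ha.mul_eq (u ⇨ v)]
      refine le_inf (mul_le_left' _ _) ((mul_le_iff _ _ _).1 ?_)
      rw [mul_comm a, mul_assoc]
      exact (himp_mul_le _ _).trans (mul_le_right' _ _)
  rw [key, hx, hy, ← key]

/-- For a Boolean element `a`, the relation `a * x = a * y` is a congruence. -/
theorem IsBool.mul_eval_congr (ha : IsBool a) {X : Type*} {w w' : X → A}
    (h : ∀ i, a * w i = a * w' i) (t : BTerm X) : a * t.eval w = a * t.eval w' := by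
  induction t with
  | var i => exact h i
  | top => rfl
  | bot => rfl
  | mul s t hs ht => exact ha.congr_mul hs ht
  | himp s t hs ht => exact ha.congr_himp hs ht
  | sup s t hs ht => simp only [BTerm.eval, mul_sup', hs, ht]
  | inf s t hs ht => exact ha.congr_inf hs ht

/-! ### The partition of unity attached to a family of elements -/

theorem isBool_neg (hA : IsStonean A) (x : A) : IsBool (neg x) := IsBool.of_sup (hA x)

variable {X : Type*} [DecidableEq X]

/-- The factor of `x i` in the product that defines `atom`. -/
def lit (w : X → A) (I : Finset X) (i : X) : A := if i ∈ I then neg (neg (w i)) else neg (w i)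

/-- The Boolean element on which exactly the `w i` with `i ∈ I` become dense, and the other
ones become `⊥`. -/
def atom [Fintype X] (w : X → A) (I : Finset X) : A := ∏ i, lit w I i

theorem isBool_lit (hA : IsStonean A) (w : X → A) (I : Finset X) (i : X) :
    IsBool (lit w I i) := by
  unfold lit
  split
  · exact isBool_neg hA _
  · exact isBool_neg hA _

theorem isBool_atom [Fintype X] (hA : IsStonean A) (w : X → A) (I : Finset X) :
    IsBool (atom w I) := IsBool.prod _ _ fun i _ => isBool_lit hA w I i

theorem atom_le_lit [Fintype X] (w : X → A) (I : Finset X) (i : X) : atom w I ≤ lit w I i := by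
  rw [atom, ← Finset.mul_prod_erase _ _ (Finset.mem_univ i)]
  exact mul_le_left' _ _

theorem eq_top_of_prod_lit_le (hA : IsStonean A) (w : X → A) (s : Finset X) (z : A)
    (h : ∀ I, ∏ i ∈ s, lit w I i ≤ z) : z = ⊤ := by
  induction s using Finset.induction_on generalizing z with
  | empty => simpa [one_eq_top] using h ∅
  | insert j s hj ih =>
    have aux (I J : Finset X) (hIJ : ∀ i ≠ j, i ∈ I ↔ i ∈ J) :
        ∏ i ∈ s, lit w I i ≤ lit w J j ⇨ z := by
      rw [← mul_le_iff, mul_comm]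
      refine le_of_eq_of_le ?_ (h J)
      rw [Finset.prod_insert hj]
      refine congrArg _ (Finset.prod_congr rfl fun i hi => ?_)
      simp only [lit, hIJ i fun h => hj (h ▸ hi)]
    have h₁ : neg (neg (w j)) ⇨ z = ⊤ := ih _ fun I => by
      simpa [lit] using aux I (insert j I) fun i hi => by simp [hi]
    have h₂ : neg (w j) ⇨ z = ⊤ := ih _ fun I => by
      simpa [lit] using aux I (I.erase j) fun i hi => by simp [hi]
    rw [← top_le_iff, ← hA (w j)]
    exact sup_le (himp_top_iff.1 h₂) (himp_top_iff.1 h₁)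

/-- The atoms of a family cover `⊤`: two elements that agree on every atom are equal. -/
theorem eq_of_atom_mul_eq [Fintype X] (hA : IsStonean A) (w : X → A)
    (h : ∀ I, atom w I * x = atom w I * y) : x = y := by
  have key {u v : A} (h : ∀ I, atom w I * u = atom w I * v) : u ≤ v :=
    himp_top_iff.1 <| eq_top_of_prod_lit_le hA w Finset.univ _ fun I =>
      (mul_le_iff _ _ _).1 ((h I).le.trans (mul_le_right' _ _))
  exact le_antisymm (key h) (key fun I => (h I).symm)

end BddResLattice

theorem BRLHom.map_atom {A : Type u} {B : Type v} [BddResLattice A] [BddResLattice B]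
    (f : BRLHom A B) {X : Type*} [DecidableEq X] [Fintype X] (w : X → A) (I : Finset X) :
    f.toFun (BddResLattice.atom w I) = BddResLattice.atom (fun i => f.toFun (w i)) I := by
  rw [BddResLattice.atom, f.map_prod, BddResLattice.atom]
  refine Finset.prod_congr rfl fun i _ => ?_
  unfold BddResLattice.lit
  split <;> simp only [f.map_neg]

/-! ### The decomposition of a free algebra -/

namespace SExt

variable {A : Type u} [ResLattice A]

theorem neg_o : BddResLattice.neg (o : SExt A) = ⊤ := rfl

theorem neg_elt (a : A) : BddResLattice.neg (elt a) = o := rfl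

theorem neg_top : BddResLattice.neg (⊤ : SExt A) = o := rfl

/-- The assignment that is `w` on `I`, and the new element off `I`. -/
def extend {X : Type*} [DecidableEq X] (I : Finset X) (w : I → A) (i : X) : SExt A :=
  if h : i ∈ I then elt (w ⟨i, h⟩) else o

variable {X : Type*} [DecidableEq X]

theorem map_extend {B : Type v} [ResLattice B] (f : RLHom A B) (I : Finset X) (w : I → A) (i : X) :
    (map f).toFun (extend I w i) = extend I (fun j => f.toFun (w j)) i := by
  unfold extend
  split <;> rfl

theorem lit_extend (I J : Finset X) (w : J → A) (i : X) :
    BddResLattice.lit (extend J w) I i = if (i ∈ I ↔ i ∈ J) then ⊤ else o := by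
  by_cases hI : i ∈ I <;> by_cases hJ : i ∈ J <;>
    simp [BddResLattice.lit, extend, hI, hJ, neg_o, neg_elt, neg_top]

theorem atom_extend [Fintype X] (I J : Finset X) (w : J → A) :
    BddResLattice.atom (extend J w) I = if I = J then ⊤ else o := by
  simp only [BddResLattice.atom, lit_extend]
  split_ifs with h
  · subst h
    exact Finset.prod_eq_one fun i _ => by simp [ResLattice.one_eq_top]
  · obtain ⟨i, hi⟩ := not_forall.1 fun h' => h (Finset.ext h')
    rw [← Finset.mul_prod_erase _ _ (Finset.mem_univ i), if_neg hi, o_mul]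

end SExt

namespace SRLVariety

variable {V : SRLVariety}

section Decomposition

variable (hV : ∃ (A : Type u) (_ : ResLattice A), V.StarMem A) {X : Type u} [DecidableEq X]

/-- The homomorphism `Free_V(X) → S(Free_{V*}(I))` that fixes the generators in `I`, and sends
the other ones to the new element. -/
def coord (I : Finset X) : BRLHom (V.Free X) (SExt (V.FreeStar I)) :=
  Free.lift (FreeStar.starMem V hV) (SExt.extend I fun i => FreeStar.mk (RTerm.var i))

theorem coord_mk (I : Finset X) (t : BTerm X) : (coord hV I).toFun (Free.mk t) =
    t.eval (SExt.extend I fun i => (FreeStar.mk (RTerm.var i) : V.FreeStar I)) := rfl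

theorem coord_surjective (I : Finset X) : Function.Surjective (coord hV I).toFun := by
  intro y
  induction y using SExt.cases with
  | ho => exact ⟨⊥, rfl⟩
  | he r =>
    induction r using Quotient.inductionOn with
    | h t =>
      change ∃ a, _ = SExt.elt (FreeStar.mk t)
      induction t with
      | var i => exact ⟨Free.mk (BTerm.var i.1), by simp [coord_mk, BTerm.eval, SExt.extend]⟩
      | top => exact ⟨⊤, rfl⟩
      | mul s t hs ht =>
        obtain ⟨a, ha⟩ := hs
        obtain ⟨b, hb⟩ := ht
        exact ⟨a * b, by rw [(coord hV I).map_mul, ha, hb]; rfl⟩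
      | himp s t hs ht =>
        obtain ⟨a, ha⟩ := hs
        obtain ⟨b, hb⟩ := ht
        exact ⟨a ⇨ b, by rw [(coord hV I).map_himp, ha, hb]; rfl⟩
      | sup s t hs ht =>
        obtain ⟨a, ha⟩ := hs
        obtain ⟨b, hb⟩ := ht
        exact ⟨a ⊔ b, ((coord hV I).map_sup a b).trans (by rw [ha, hb]; rfl)⟩
      | inf s t hs ht =>
        obtain ⟨a, ha⟩ := hs
        obtain ⟨b, hb⟩ := ht
        exact ⟨a ⊓ b, ((coord hV I).map_inf a b).trans (by rw [ha, hb]; rfl)⟩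

variable [Fintype X]

/-- The atoms of the generators are mapped to the unit vectors of the product. -/
theorem coord_atom (I J : Finset X) :
    (coord hV J).toFun
        (BddResLattice.atom (fun i => (Free.mk (BTerm.var i) : V.Free X)) I) =
      if I = J then ⊤ else SExt.o := by
  rw [(coord hV J).map_atom]
  exact SExt.atom_extend I J fun i => (FreeStar.mk (RTerm.var i) : V.FreeStar J)

/-- Terms with equal values under all the homomorphisms `coord I` have equal values in `V`: on the
atom of `I`, an assignment `w` agrees with one whose values off `I` are `⊥`, and whose values on
`I` are dense, so that it factors through `S(D(A))`. -/
theorem eval_eq_of_coord_eq {s t : BTerm X}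
    (h : ∀ I, (coord hV I).toFun (Free.mk s) = (coord hV I).toFun (Free.mk t))
    {A : Type u} [BddResLattice A] (hA : V.Mem A) (w : X → A) : s.eval w = t.eval w := by
  by_cases hne : (⊤ : A) = ⊥
  · have htop (x : A) : x = ⊤ := top_le_iff.1 (hne.trans_le bot_le)
    exact (htop _).trans (htop _).symm
  refine BddResLattice.eq_of_atom_mul_eq hA.1 w fun I => ?_
  set a := BddResLattice.atom w I with ha_def
  have ha : BddResLattice.IsBool a := BddResLattice.isBool_atom hA.1 w I
  have hlit (i : X) : a ≤ BddResLattice.lit w I i := BddResLattice.atom_le_lit w I i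
  have hdense (i : I) : BddResLattice.IsDense (w i ⊔ BddResLattice.neg a) := by
    have h1 := hlit i
    rw [BddResLattice.lit, if_pos i.2] at h1
    rw [BddResLattice.IsDense, BddResLattice.neg_sup, ha.neg_neg, ← le_bot_iff,
      ← (BddResLattice.isBool_neg hA.1 (w i)).2]
    exact inf_le_inf le_rfl h1
  let d : I → DAlg A := fun i => ⟨w i ⊔ BddResLattice.neg a, hdense i⟩
  have hw (i : X) : a * w i = a * (DAlg.sExtHom A).toFun (SExt.extend I d i) := by
    by_cases hi : i ∈ I
    · have : (DAlg.sExtHom A).toFun (SExt.extend I d i) = w i ⊔ BddResLattice.neg a := by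
        rw [SExt.extend, dif_pos hi]
        rfl
      rw [this, ResLattice.mul_sup', BddResLattice.mul_neg, sup_bot_eq]
    · have : (DAlg.sExtHom A).toFun (SExt.extend I d i) = ⊥ := by
        rw [SExt.extend, dif_neg hi]
        rfl
      have h1 := hlit i
      rw [BddResLattice.lit, if_neg hi] at h1
      rw [this, BddResLattice.le_neg_iff.1 h1]
      exact (le_bot_iff.1 (ResLattice.mul_le_right' _ _)).symm
  have hcoord (t : BTerm X) : t.eval (SExt.extend I d) =
      (SExt.map (FreeStar.lift (starMem_dAlg hA hne) d)).toFun
        ((coord hV I).toFun (Free.mk t)) := by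
    rw [coord_mk, BRLHom.map_eval]
    simp only [SExt.map_extend]
    rfl
  rw [ha.mul_eval_congr hw s, ha.mul_eval_congr hw t, ← BRLHom.map_eval, ← BRLHom.map_eval,
    hcoord, hcoord, h I]

/-- The free algebra over a finite set `X` is the product over the subsets `I` of `X` of the
algebras `S(Free_{V*}(I))`. -/
def freeDecomposition :
    BRLIso (V.Free X) (∀ I : Finset X, SExt (V.FreeStar I)) where
  toFun x I := (coord hV I).toFun x
  map_mul x y := funext fun I => (coord hV I).map_mul _ _
  map_himp x y := funext fun I => (coord hV I).map_himp _ _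
  map_sup x y := funext fun I => (coord hV I).map_sup _ _
  map_inf x y := funext fun I => (coord hV I).map_inf _ _
  map_top := rfl
  map_bot := rfl
  bijective := by
    constructor
    · intro x y
      refine Quotient.inductionOn₂ x y fun s t h => Quotient.sound fun A _ hA w => ?_
      exact eval_eq_of_coord_eq hV (fun I => congrFun h I) hA w
    · intro y
      choose u hu using fun I => coord_surjective hV I (y I)
      -- Off its own index, each factor below is mapped to `o ⇨ _ = ⊤`.
      refine ⟨∏ I, (BddResLattice.atom (fun i => Free.mk (BTerm.var i)) I ⇨ u I),
        funext fun J => ?_⟩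
      change (coord hV J).toFun _ = y J
      rw [RLHom.map_prod, Finset.prod_eq_single J]
      · rw [RLHom.map_himp, coord_atom, if_pos rfl, hu, ← ResLattice.top_mul' (⊤ ⇨ y J)]
        refine le_antisymm (ResLattice.mul_himp_le _ _) ?_
        rw [ResLattice.top_mul', ← ResLattice.mul_le_iff, ResLattice.mul_top']
      · intro I _ hI
        rw [RLHom.map_himp, coord_atom, if_neg hI, SExt.o_himp, ResLattice.one_eq_top]
      · exact fun h => absurd (Finset.mem_univ J) h

end Decomposition

/-- Renaming the generators. -/
def freeStarCongr (hV : ∃ (A : Type u) (_ : ResLattice A), V.StarMem A) {X Y : Type u}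
    (e : X ≃ Y) : RLIso (V.FreeStar X) (V.FreeStar Y) where
  toRLHom := FreeStar.lift (FreeStar.starMem V hV) fun x => FreeStar.mk (RTerm.var (e x))
  bijective := by
    have key {X Y : Type u} (e : X ≃ Y) (x : V.FreeStar X) :
        (FreeStar.lift (FreeStar.starMem V hV) fun y =>
          (FreeStar.mk (RTerm.var (e.symm y)) : V.FreeStar X)).toFun
        ((FreeStar.lift (FreeStar.starMem V hV) fun x =>
          (FreeStar.mk (RTerm.var (e x)) : V.FreeStar Y)).toFun x) = x := by
      induction x using Quotient.inductionOn with
      | h t =>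
        refine (RLHom.map_eval _ _ t).trans (Eq.trans ?_ (FreeStar.mk_eval V t))
        refine congrArg (fun w => t.eval w) (funext fun x => ?_)
        change FreeStar.mk (RTerm.var (e.symm (e x))) = _
        rw [e.symm_apply_apply]
    exact Function.bijective_iff_has_inverse.2 ⟨_, key e, key e.symm⟩

/-- If `V` contains the Boolean algebras, the trivial residuated lattice is in `V*`. -/
theorem exists_starMem
    (hV : ∀ (A : Type) [BddResLattice A], IsBooleanRL A → V.Mem A) :
    ∃ (A : Type) (_ : ResLattice A), V.StarMem A := by
  refine ⟨∀ _ : Empty, V.FreeStar Empty, inferInstance, hV _ fun x => ?_⟩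
  apply BddResLattice.IsBool.of_sup
  induction x using SExt.cases with
  | ho => rfl
  | he a =>
    rw [SExt.neg_elt, SExt.sup_o, SExt.top_eq]
    exact congrArg SExt.elt (Subsingleton.elim _ _)

end SRLVariety

/-! ### Enumerations of the subsets of a finite set -/

/-- The subsets of `Fin n`, arranged by cardinality. -/
theorem exists_sigma_equiv_finset (n : ℕ) :
    ∃ e : (Σ k : Fin (n + 1), Fin (n.choose k)) ≃ Finset (Fin n), ∀ p, (e p).card = p.1 := by
  let f : Finset (Fin n) → Fin (n + 1) := fun I =>
    ⟨I.card, Nat.lt_succ_of_le (by simpa using I.card_le_univ)⟩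
  have e (k : Fin (n + 1)) : Nonempty (Fin (n.choose k) ≃ {I // f I = k}) := by
    refine ⟨Fintype.equivOfCardEq ?_⟩
    have h := Fintype.card_finset_len (α := Fin n) (k : ℕ)
    rw [Fintype.card_fin] at h
    rw [Fintype.card_fin, ← h]
    exact Fintype.card_congr (Equiv.subtypeEquivRight fun I => by simp [f, Fin.ext_iff])
  exact ⟨(Equiv.sigmaCongrRight fun k => (e k).some).trans (Equiv.sigmaFiberEquiv f),
    fun p => congrArg Fin.val ((e p.1).some p.2).2⟩

/-- In the lexicographic enumeration of the pairs `(k, i)` with `i < n.choose k`, the `j`-th pair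
(counted from `0`) has the first component `kIndex n (j + 1)`. -/
theorem exists_fin_equiv_sigma (n : ℕ) :
    ∃ e : Fin (2 ^ n) ≃ Σ k : Fin (n + 1), Fin (n.choose k),
      ∀ j, ((e j).1 : ℕ) = kIndex n (j + 1) := by
  have hsum : ∑ k : Fin (n + 1), n.choose k = 2 ^ n := by
    rw [Fin.sum_univ_eq_sum_range (fun k => n.choose k), Nat.sum_range_choose]
  refine ⟨((finSigmaFinEquiv (n := fun k : Fin (n + 1) => n.choose k)).trans
    (finCongr hsum)).symm, fun j => ?_⟩
  obtain ⟨p, rfl⟩ := ((finSigmaFinEquiv (n := fun k : Fin (n + 1) => n.choose k)).trans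
    (finCongr hsum)).surjective j
  rw [Equiv.symm_apply_apply]
  have hval : ((((finSigmaFinEquiv (n := fun k : Fin (n + 1) => n.choose k)).trans
      (finCongr hsum)) p : Fin (2 ^ n)) : ℕ) = ∑ l ∈ Finset.range p.1, n.choose l + p.2 := by
    rw [Equiv.trans_apply, finCongr_apply, Fin.val_cast, finSigmaFinEquiv_apply,
      ← Fin.sum_univ_eq_sum_range (fun k => n.choose k)]
    rfl
  rw [hval]
  have hmem : (p.1 : ℕ) ∈ {k : ℕ | ∑ l ∈ Finset.range p.1, n.choose l + p.2 + 1 ≤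
      ∑ l ∈ Finset.range (k + 1), n.choose l} := by
    have := p.2.2
    rw [Set.mem_ofPred_eq, Finset.sum_range_succ]
    omega
  refine le_antisymm (le_csInf ⟨_, hmem⟩ fun k hk => ?_) (Nat.sInf_le hmem)
  by_contra! hlt
  have h1 := Finset.sum_le_sum_of_subset (f := fun l => n.choose l)
    (Finset.range_subset_range.2 (Nat.succ_le_of_lt hlt))
  simp only [Nat.succ_eq_add_one] at h1
  rw [Set.mem_ofPred_eq] at hk
  omega

/-! ### Isomorphisms of triples -/

/-- A pair of isomorphisms that preserves and reflects membership in the filters is an isomorphism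
of triples. -/
noncomputable def Triple.isoMk {T₁ T₂ : Triple.{u}} (h : T₁.B ≃o T₂.B) (k : RLIso T₁.D T₂.D)
    (hφ : ∀ a d, d ∈ T₁.φ a ↔ k.toFun d ∈ T₂.φ (h a)) : T₁ ≅ T₂ where
  hom := (⟨(h : BoundedLatticeHom T₁.B T₂.B), k.toRLHom, fun a d => (hφ a d).1⟩ : Triple.Hom T₁ T₂)
  inv := (⟨(h.symm : BoundedLatticeHom T₂.B T₁.B), k.symm.toRLHom, fun a d hd =>
    (hφ _ _).2 (by
      rw [k.apply_symm_apply]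
      exact (h.apply_symm_apply a).symm ▸ hd)⟩ : Triple.Hom T₂ T₁)
  hom_inv_id := Triple.Hom.ext (DFunLike.ext _ _ h.symm_apply_apply)
    (RLHom.ext (funext k.symm_apply_apply))
  inv_hom_id := Triple.Hom.ext (DFunLike.ext _ _ h.apply_symm_apply)
    (RLHom.ext (funext k.apply_symm_apply))

namespace BRLIso

open BddResLattice

variable {A B : Type u} [BddResLattice A] [BddResLattice B] (f : BRLIso A B)

theorem le_iff {x y : A} : f.toFun x ≤ f.toFun y ↔ x ≤ y := by
  rw [← sup_eq_right, ← f.map_sup, f.bijective.1.eq_iff, sup_eq_right]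

theorem isDense_iff {x : A} : IsDense (f.toFun x) ↔ IsDense x := by
  rw [IsDense, ← f.map_neg, ← f.map_bot, f.bijective.1.eq_iff, IsDense]

theorem isBool_iff {x : A} : IsBool (f.toFun x) ↔ IsBool x := by
  rw [IsBool, ← f.map_neg, ← f.map_bot, ← f.map_top, ← f.map_sup, ← f.map_inf,
    f.bijective.1.eq_iff, f.bijective.1.eq_iff, IsBool]

/-- The restriction of an isomorphism to the Boolean skeletons. -/
noncomputable def bSkel : BSkel A ≃o BSkel B where
  toEquiv := (Equiv.ofBijective f.toFun f.bijective).subtypeEquiv fun _ => f.isBool_iff.symm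
  map_rel_iff' := f.le_iff

/-- The restriction of an isomorphism to the algebras of dense elements. -/
noncomputable def dAlg : RLIso (DAlg A) (DAlg B) where
  toFun x := ⟨f.toFun x.1, f.isDense_iff.2 x.2⟩
  map_mul x y := Subtype.ext (f.map_mul x.1 y.1)
  map_himp x y := Subtype.ext (f.map_himp x.1 y.1)
  map_sup x y := Subtype.ext (f.map_sup x.1 y.1)
  map_inf x y := Subtype.ext (f.map_inf x.1 y.1)
  map_top := Subtype.ext f.map_top
  bijective := ((Equiv.ofBijective f.toFun f.bijective).subtypeEquiv
    fun _ => f.isDense_iff.symm).bijective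

/-- Isomorphic algebras have isomorphic triples. -/
noncomputable def triple : tripleOf A ≅ tripleOf B :=
  Triple.isoMk f.bSkel f.dAlg fun a d => by
    change neg a.1 ≤ d.1 ↔ neg (f.toFun a.1) ≤ f.toFun d.1
    rw [← f.map_neg, f.le_iff]

end BRLIso

/-! ### The triple of a product of algebras `S(D)` -/

namespace SExt

open BddResLattice

theorem eq_o_or_eq_top {D : Type u} [ResLattice D] {x : SExt D} (hx : x ⊔ neg x = ⊤) :
    x = o ∨ x = ⊤ := by
  induction x using SExt.cases with
  | ho => exact Or.inl rfl
  | he a => exact Or.inr (by rwa [neg_elt, sup_o] at hx)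

variable {ι : Type} {D : ι → Type} [∀ j, ResLattice (D j)]

theorem isBool_pi_iff {x : ∀ j, SExt (D j)} : IsBool x ↔ ∀ j, x j = o ∨ x j = ⊤ := by
  refine ⟨fun h j => eq_o_or_eq_top (congrFun h.1 j), fun h => IsBool.of_sup (funext fun j => ?_)⟩
  change x j ⊔ neg (x j) = ⊤
  obtain h | h := h j <;> rw [h]
  · rfl
  · simp

/-- The Boolean elements of a product of algebras `S(D j)` are the families of bits. -/
noncomputable def bSkelPi : (ι → Bool) ≃o BSkel (∀ j, SExt (D j)) where
  toFun b := ⟨fun j => if b j then ⊤ else o, isBool_pi_iff.2 fun j => by cases b j <;> simp⟩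
  invFun x j := by
    classical exact decide (x.1 j = ⊤)
  left_inv b := funext fun j => by
    cases h : b j <;> simp [h, top_eq, (elt_ne_o _).symm]
  right_inv x := Subtype.ext <| funext fun j => by
    obtain h | h := isBool_pi_iff.1 x.2 j <;> simp [h, top_eq, (elt_ne_o _).symm]
  map_rel_iff' {b c} := by
    refine forall_congr' fun j => ?_
    change ((if b j then ⊤ else o : SExt (D j)) ≤ if c j then ⊤ else o) ↔ b j ≤ c j
    cases b j <;> cases c j <;> simp [o_le, top_eq, not_elt_le_o]

theorem isDense_pi_elt (d : ∀ j, D j) : IsDense fun j => elt (d j) := rfl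

/-- The dense elements of a product of algebras `S(D j)` are the families of old elements. -/
def dAlgPi : RLIso (∀ j, D j) (DAlg (∀ j, SExt (D j))) where
  toFun d := ⟨fun j => elt (d j), isDense_pi_elt d⟩
  map_mul _ _ := rfl
  map_himp _ _ := rfl
  map_sup _ _ := rfl
  map_inf _ _ := rfl
  map_top := rfl
  bijective := by
    refine ⟨fun d d' h => funext fun j => elt_injective (congrFun (congrArg Subtype.val h) j),
      fun x => ?_⟩
    have h (j : ι) : ∃ d : D j, elt d = x.1 j := by
      have hj : neg (x.1 j) = ⊥ := congrFun x.2 j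
      generalize x.1 j = y at hj
      induction y using SExt.cases with
      | ho => exact absurd hj (elt_ne_o _)
      | he a => exact ⟨a, rfl⟩
    choose d hd using h
    exact ⟨d, Subtype.ext (funext hd)⟩

variable (D) in
/-- The triple of a product of algebras `S(D j)` is the one described by coordinates. -/
noncomputable def coordinateTripleIso :
    coordinateTriple ι D ≅ tripleOf (∀ j, SExt (D j)) :=
  Triple.isoMk bSkelPi dAlgPi fun b d => by
    refine forall_congr' fun j => ?_
    change d j ∈ trivialOrWhole (D j) (b j) ↔
      neg (if b j then ⊤ else o : SExt (D j)) ≤ elt (d j)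
    cases b j with
    | false =>
      change d j = ⊤ ↔ (⊤ : SExt (D j)) ≤ elt (d j)
      rw [top_eq, elt_le, top_le_iff]
    | true => exact ⟨fun _ => o_le _, fun _ => trivial⟩

end SExt

/-! ### Free algebras on `n` generators -/

theorem theorem4p7 (V : SRLVariety) (hV : V.ProperlyContainsBoolean) (n : ℕ) :
    Nonempty (BRLIso (V.Free (Fin n))
      (∀ k : Fin (n + 1), Fin (n.choose k) → SExt (V.FreeStar (Fin k)))) ∧
    Nonempty (tripleOf (V.Free (Fin n)) ≅
      coordinateTriple (Fin (2 ^ n)) (fun j => V.FreeStar (Fin (kIndex n (j + 1))))) ∧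
    Nonempty (RLIso (∀ k : Fin (n + 1), Fin (n.choose k) → V.FreeStar (Fin k))
      (∀ j : Fin (2 ^ n), V.FreeStar (Fin (kIndex n (j + 1))))) := by
  have hS := SRLVariety.exists_starMem hV.1
  obtain ⟨e, he⟩ := exists_sigma_equiv_finset n
  obtain ⟨e', he'⟩ := exists_fin_equiv_sigma n
  have F : BRLIso (V.Free (Fin n)) _ := SRLVariety.freeDecomposition hS
  have rename (I : Finset (Fin n)) (k : ℕ) (h : I.card = k) :
      RLIso (V.FreeStar I) (V.FreeStar (Fin k)) :=
    SRLVariety.freeStarCongr hS (I.equivFinOfCardEq h)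
  refine ⟨⟨?_⟩, ⟨?_⟩, ⟨?_⟩⟩
  · let G : RLIso (∀ I : Finset (Fin n), SExt (V.FreeStar I))
        (∀ p : Σ k : Fin (n + 1), Fin (n.choose k), SExt (V.FreeStar (Fin p.1))) :=
      RLIso.piCongr e fun p => (rename _ _ (he p)).sExt
    exact (((RLIso.mk F.toRLHom F.bijective).trans G).trans
      (RLIso.piCurry (F := fun k : Fin (n + 1) => SExt (V.FreeStar (Fin k))))).toBRLIso
  · let G : RLIso (∀ I : Finset (Fin n), SExt (V.FreeStar I))
        (∀ j : Fin (2 ^ n), SExt (V.FreeStar (Fin (kIndex n (j + 1))))) :=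
      RLIso.piCongr (e'.trans e) fun j => (rename _ _ ((he (e' j)).trans (he' j))).sExt
    exact ((RLIso.mk F.toRLHom F.bijective).trans G).toBRLIso.triple ≪≫
      (SExt.coordinateTripleIso _).symm
  · let G : RLIso (∀ p : Σ k : Fin (n + 1), Fin (n.choose k), V.FreeStar (Fin p.1))
        (∀ j : Fin (2 ^ n), V.FreeStar (Fin (kIndex n (j + 1)))) :=
      RLIso.piCongr e' fun j => SRLVariety.freeStarCongr hS (finCongr (he' j))
    exact (RLIso.piCurry (F := fun k : Fin (n + 1) => V.FreeStar (Fin k))).symm.trans G
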